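/- Let $\mathscr U,\mathscr X,\mathscr Y$ be finite-dimensional real vector spaces and let $A:\mathscr X\to\mathscr X$, $B:\mathscr U\to\mathscr X$, $C:\mathscr X\to\mathscr Y$ be linear maps, defining the system $x^+=Ax+Bu$, $y=Cx$. Here $x^+$ denotes either $dx/dt$ on a given interval $[0,T]$, $T>0$ (continuous time, with continuous input signals), or $x(t+1)$ for $t=0,1,2,\dots$ (discrete time). A system is called left-invertible if, for every initial state, two input signals that produce the same output signal coincide. Assume that $(A,B)$ is controllable, that $(C,A)$ is observable, and that the system $\{C,A,B\}$ is left-invertible. Assume that the system is weakly output-redundant, i.e. $\dim\mathscr Y>\dim\mathscr U$ and $\dim(\operatorname{im}C)=\dim\mathscr Y$. An unobservability subspace is a subspace of the form $\langle\ker HC\,|\,A+LC\rangle$, the largest $(A+LC)$-invariant subspace contained in $\ker HC$, for some linear $L:\mathscr Y\to\mathscr X$ and $H:\mathscr Y\to\mathscr Y$. Let $\mathscr S^*$ be the infimal unobservability subspace containing $\operatorname{im}B$. Then for every linear map $L:\mathscr Y\to\mathscr X$ that is a friend of $\mathscr S^*$, i.e. $(A+LC)\mathscr S^*\subseteq\mathscr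 S^*$, there exists a subspace $\mathscr D\neq0$ of $\mathscr Y$ with $\mathscr D\subseteq C\mathscr S^*$ such that the system $$\bar x^+=\bar A_L\bar x+\bar D_L d,\qquad \bar y=\bar C\bar x,$$ with input $d\in\mathscr D$, state $\bar x\in\mathscr X/\mathscr S^*$ and output $\bar y\in\mathscr Y/(C\mathscr S^*)$, is left-invertible (in the same time domain). Here $\bar A_L$ is the map induced by $A+LC$ on $\mathscr X/\mathscr S^*$, $\bar C:\mathscr X/\mathscr S^*\to\mathscr Y/(C\mathscr S^*)$ is the map induced by $C$, and $\bar D_L=PLD$, where $D:\mathscr D\to\mathscr Y$ is the insertion map and $P:\mathscr X\to\mathscr X/\mathscr S^*$ is the canonical projection. -/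

import Mathlib

/-!
Linear time-invariant systems in the geometric approach: invariant subspaces,
unobservability subspaces, friends, quotient systems, and left-invertibility.
All spaces are real vector spaces; finite-dimensionality is assumed in the theorem.
-/

namespace LTI

variable {U X Y : Type*} [AddCommGroup U] [Module ℝ U] [AddCommGroup X] [Module ℝ X]
  [AddCommGroup Y] [Module ℝ Y]

/-- `W` is invariant with respect to the endomorphism `A`, i.e. `A W ⊆ W`. -/
def IsInvariant (A : X →ₗ[ℝ] X) (W : Submodule ℝ X) : Prop :=
  W ≤ W.comap A

/-- `⟨A | E⟩`: the smallest `A`-invariant subspace that contains `E`. -/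
def reachableSubspace (A : X →ₗ[ℝ] X) (E : Submodule ℝ X) : Submodule ℝ X :=
  sInf {W | IsInvariant A W ∧ E ≤ W}

/-- `⟨K | A⟩`: the largest `A`-invariant subspace that is contained in `K`. -/
def unobservableSubspace (K : Submodule ℝ X) (A : X →ₗ[ℝ] X) : Submodule ℝ X :=
  sSup {W | IsInvariant A W ∧ W ≤ K}

/-- The pair `(A, B)` is controllable: `⟨A | im B⟩` is the whole state space. -/
def IsControllable (A : X →ₗ[ℝ] X) (B : U →ₗ[ℝ] X) : Prop :=
  reachableSubspace A (LinearMap.range B) = ⊤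

/-- The pair `(C, A)` is observable: `⟨ker C | A⟩ = 0`. -/
def IsObservable (C : X →ₗ[ℝ] Y) (A : X →ₗ[ℝ] X) : Prop :=
  unobservableSubspace (LinearMap.ker C) A = ⊥

/-- The output-injection map `L : Y → X` is a friend of the subspace `W`:
`(A + L C) W ⊆ W`. -/
def IsOutputFriend (C : X →ₗ[ℝ] Y) (A : X →ₗ[ℝ] X) (W : Submodule ℝ X)
    (L : Y →ₗ[ℝ] X) : Prop :=
  IsInvariant (A + L ∘ₗ C) W

/-- `S` is an unobservability subspace of `(C, A)`: `S = ⟨ker (H C) | A + L C⟩` for some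
output-injection map `L : Y → X` and some measurement mixing map `H : Y → Y`. -/
def IsUnobservabilitySubspace (C : X →ₗ[ℝ] Y) (A : X →ₗ[ℝ] X) (S : Submodule ℝ X) : Prop :=
  ∃ (L : Y →ₗ[ℝ] X) (H : Y →ₗ[ℝ] Y),
    S = unobservableSubspace (LinearMap.ker (H ∘ₗ C)) (A + L ∘ₗ C)

/-- `S*(C, A; im B)`: the infimal unobservability subspace of `(C, A)` that contains `im B`. -/
def infUnobservabilitySubspace (C : X →ₗ[ℝ] Y) (A : X →ₗ[ℝ] X) (B : U →ₗ[ℝ] X) :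
    Submodule ℝ X :=
  sInf {S | IsUnobservabilitySubspace C A S ∧ LinearMap.range B ≤ S}

/-- The system `{C, A, B}` with `m = dim U` and `p = dim Y` is weakly output-redundant:
`p > m` and `dim (im C) = p`. It depends on `A` and `B` only through their domains. -/
def IsWeaklyOutputRedundant (C : X →ₗ[ℝ] Y) (_A : X →ₗ[ℝ] X) (_B : U →ₗ[ℝ] X) : Prop :=
  Module.finrank ℝ U < Module.finrank ℝ Y ∧
    Module.finrank ℝ (LinearMap.range C) = Module.finrank ℝ Y

/-! ### The quotient system -/

/-- The map `X/S → X/S` induced by `A + L C`, for a friend `L` of `S`. -/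
def quotientState (C : X →ₗ[ℝ] Y) (A : X →ₗ[ℝ] X) {S : Submodule ℝ X} {L : Y →ₗ[ℝ] X}
    (hL : IsOutputFriend C A S L) : (X ⧸ S) →ₗ[ℝ] (X ⧸ S) :=
  S.mapQ S (A + L ∘ₗ C) hL

/-- The map `X/S → Y/(C S)` induced by `C`. -/
def quotientOutput (C : X →ₗ[ℝ] Y) (S : Submodule ℝ X) :
    (X ⧸ S) →ₗ[ℝ] (Y ⧸ S.map C) :=
  S.mapQ (S.map C) C (Submodule.le_comap_map C S)

/-- The map `P L D : 𝒟 → X/S`, where `D : 𝒟 → Y` is the insertion map of `𝒟` and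
`P : X → X/S` is the canonical projection. -/
def quotientDisturbance (S : Submodule ℝ X) (L : Y →ₗ[ℝ] X) (D : Submodule ℝ Y) :
    D →ₗ[ℝ] (X ⧸ S) :=
  S.mkQ ∘ₗ L ∘ₗ D.subtype

/-! ### Left-invertibility -/

/-- The time domain of a system: either continuous time on an interval `[0, T]` with `T > 0`,
or discrete time `0, 1, 2, …`. -/
inductive TimeDomain : Type
  | continuous (T : ℝ) (hT : 0 < T) : TimeDomain
  | discrete : TimeDomain

/-- The signal `u` is continuous on `[0, T]`. Since a finite-dimensional real space carries
no preferred norm, this is expressed by means of all linear functionals. -/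
def ContinuousSignal (T : ℝ) (u : ℝ → U) : Prop :=
  ∀ φ : Module.Dual ℝ U, ContinuousOn (fun t => φ (u t)) (Set.Icc 0 T)

/-- `x` solves `dx/dt = A x + B u` on `[0, T]` with `x(0) = x₀`; the derivative is one-sided
at the end points and, as above, it is taken along all linear functionals. -/
def IsContinuousTrajectory (T : ℝ) (A : X →ₗ[ℝ] X) (B : U →ₗ[ℝ] X) (x₀ : X)
    (u : ℝ → U) (x : ℝ → X) : Prop :=
  x 0 = x₀ ∧ ∀ t ∈ Set.Icc 0 T, ∀ φ : Module.Dual ℝ X,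
    HasDerivWithinAt (fun s => φ (x s)) (φ (A (x t) + B (u t))) (Set.Icc 0 T) t

/-- `x` solves `x(t+1) = A x(t) + B u(t)` for `t = 0, 1, 2, …` with `x(0) = x₀`. -/
def IsDiscreteTrajectory (A : X →ₗ[ℝ] X) (B : U →ₗ[ℝ] X) (x₀ : X)
    (u : ℕ → U) (x : ℕ → X) : Prop :=
  x 0 = x₀ ∧ ∀ t, x (t + 1) = A (x t) + B (u t)

/-- The system `x⁺ = A x + B u`, `y = C x` is left-invertible: for every initial state, two
input signals that produce the same output signal coincide. -/
def IsLeftInvertible (C : X →ₗ[ℝ] Y) (A : X →ₗ[ℝ] X) (B : U →ₗ[ℝ] X) : TimeDomain → Prop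
  | .continuous T _ =>
      ∀ (x₀ : X) (u₁ u₂ : ℝ → U) (x₁ x₂ : ℝ → X),
        ContinuousSignal T u₁ → ContinuousSignal T u₂ →
        IsContinuousTrajectory T A B x₀ u₁ x₁ → IsContinuousTrajectory T A B x₀ u₂ x₂ →
        (∀ t ∈ Set.Icc 0 T, C (x₁ t) = C (x₂ t)) → ∀ t ∈ Set.Icc 0 T, u₁ t = u₂ t
  | .discrete =>
      ∀ (x₀ : X) (u₁ u₂ : ℕ → U) (x₁ x₂ : ℕ → X),
        IsDiscreteTrajectory A B x₀ u₁ x₁ → IsDiscreteTrajectory A B x₀ u₂ x₂ →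
        (∀ t, C (x₁ t) = C (x₂ t)) → ∀ t, u₁ t = u₂ t

end LTI

namespace LTI

/-! ### Conditioned invariant and unobservability subspaces. -/

section Geometric

variable {U X Y : Type*} [AddCommGroup U] [Module ℝ U] [AddCommGroup X] [Module ℝ X]
  [AddCommGroup Y] [Module ℝ Y]

/-! Output redundancy forces `S* ≠ X` (`infUnobservabilitySubspace_ne_top`). If `L` mapped `C S*`
into `S*`, the friend property would make `S*` invariant under `A` itself; as it contains `im B`,
controllability would give `S* = X`. So some `d ∈ C S*` has `L d ∉ S*`, and `𝒟 = span {d}` works.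
The quotient system is observable (`isObservable_quotient`), so its scalar input, entering along a
nonzero vector, has a nonzero Markov parameter. The first such one is injective on a line, and hence
the input can be recovered from the output. -/

theorem le_unobservableSubspace {K W : Submodule ℝ X} {A : X →ₗ[ℝ] X}
    (hW : IsInvariant A W) (hK : W ≤ K) : W ≤ unobservableSubspace K A :=
  le_sSup ⟨hW, hK⟩

theorem unobservableSubspace_le (K : Submodule ℝ X) (A : X →ₗ[ℝ] X) :
    unobservableSubspace K A ≤ K :=
  sSup_le fun _ h => h.2

theorem isInvariant_unobservableSubspace (K : Submodule ℝ X) (A : X →ₗ[ℝ] X) :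
    IsInvariant A (unobservableSubspace K A) :=
  sSup_le fun _ h => h.1.trans (Submodule.comap_mono (le_sSup h))

theorem IsControllable.eq_top {A : X →ₗ[ℝ] X} {B : U →ₗ[ℝ] X} (h : IsControllable A B)
    {W : Submodule ℝ X} (hW : IsInvariant A W) (hB : LinearMap.range B ≤ W) : W = ⊤ :=
  top_le_iff.1 (h ▸ sInf_le ⟨hW, hB⟩)

/-- Every conditioned invariant subspace `W`, i.e. one with `A (W ∩ ker C) ⊆ W`, has a friend. -/
theorem exists_isOutputFriend (C : X →ₗ[ℝ] Y) (A : X →ₗ[ℝ] X) {W : Submodule ℝ X}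
    (hW : W ⊓ LinearMap.ker C ≤ W.comap A) : ∃ L : Y →ₗ[ℝ] X, IsOutputFriend C A W L := by
  obtain ⟨s, hs⟩ := (C.domRestrict W).rangeRestrict.exists_rightInverse_of_surjective
    (LinearMap.range_rangeRestrict _)
  -- With `s` a section of `C` on `W`, this choice gives `(A + L C) w = A (w - s (C w))`, and `w - s
  -- (C w) ∈ W ⊓ ker C`.
  obtain ⟨L, hL⟩ := LinearMap.exists_extend (-(A ∘ₗ W.subtype ∘ₗ s))
  refine ⟨L, fun w hw => ?_⟩
  have hCw : C w ∈ LinearMap.range (C.domRestrict W) := ⟨⟨w, hw⟩, rfl⟩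
  have h1 : L (C w) = -A (s ⟨C w, hCw⟩) := LinearMap.congr_fun hL ⟨C w, hCw⟩
  have h2 : C (s ⟨C w, hCw⟩) = C w :=
    congrArg Subtype.val (LinearMap.congr_fun hs ⟨C w, hCw⟩)
  have h3 : w - s ⟨C w, hCw⟩ ∈ W ⊓ LinearMap.ker C :=
    ⟨W.sub_mem hw (s ⟨C w, hCw⟩).2, by simp [h2]⟩
  have h4 := hW h3
  rw [Submodule.mem_comap, map_sub] at h4
  simpa [h1, sub_eq_add_neg] using h4

/-- There is a conditioned invariant subspace `W = im B + A (W ∩ ker C)`. -/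
theorem exists_eq_range_sup_map (C : X →ₗ[ℝ] Y) (A : X →ₗ[ℝ] X) (B : U →ₗ[ℝ] X) :
    ∃ W : Submodule ℝ X, W = LinearMap.range B ⊔ (W ⊓ LinearMap.ker C).map A := by
  let f : Submodule ℝ X →o Submodule ℝ X :=
    ⟨fun W => LinearMap.range B ⊔ (W ⊓ LinearMap.ker C).map A, fun V W h =>
      sup_le_sup_left (Submodule.map_mono (inf_le_inf_right _ h)) _⟩
  exact ⟨f.lfp, f.map_lfp.symm⟩

theorem finrank_map_le_of_eq_range_sup_map [FiniteDimensional ℝ U] [FiniteDimensional ℝ X]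
    {C : X →ₗ[ℝ] Y} {A : X →ₗ[ℝ] X} {B : U →ₗ[ℝ] X} {W : Submodule ℝ X}
    (hW : W = LinearMap.range B ⊔ (W ⊓ LinearMap.ker C).map A) :
    Module.finrank ℝ (W.map C) ≤ Module.finrank ℝ U := by
  have h1 : Module.finrank ℝ W ≤
      Module.finrank ℝ U + Module.finrank ℝ (W ⊓ LinearMap.ker C : Submodule ℝ X) := by
    conv_lhs => rw [hW]
    exact (Submodule.finrank_add_le_finrank_add_finrank _ _).trans
      (add_le_add B.finrank_range_le (Submodule.finrank_map_le _ _))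
  have h2 := (C.domRestrict W).finrank_range_add_finrank_ker
  have h3 : Module.finrank ℝ (LinearMap.ker (C.domRestrict W)) =
      Module.finrank ℝ (W ⊓ LinearMap.ker C : Submodule ℝ X) := by
    have h : (LinearMap.ker (C.domRestrict W)).map W.subtype = W ⊓ LinearMap.ker C := by
      rw [LinearMap.ker_domRestrict, Submodule.map_comap_subtype]
    rw [← h, Submodule.finrank_map_subtype_eq]
  rw [LinearMap.range_domRestrict] at h2
  omega

theorem infUnobservabilitySubspace_le {C : X →ₗ[ℝ] Y} {A : X →ₗ[ℝ] X} {B : U →ₗ[ℝ] X}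
    {S : Submodule ℝ X} (hS : IsUnobservabilitySubspace C A S) (hB : LinearMap.range B ≤ S) :
    infUnobservabilitySubspace C A B ≤ S :=
  sInf_le ⟨hS, hB⟩

theorem range_le_infUnobservabilitySubspace (C : X →ₗ[ℝ] Y) (A : X →ₗ[ℝ] X) (B : U →ₗ[ℝ] X) :
    LinearMap.range B ≤ infUnobservabilitySubspace C A B :=
  le_sInf fun _ h => h.2

/-- For `W = im B + A (W ∩ ker C)`, rank-nullity gives `dim C W ≤ dim U < dim Y`. A nonzero
functional vanishing on `C W` yields a rank-one `H` with `W ≤ ker (H C) ≠ X`; a friend of `W` then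
gives a proper unobservability subspace containing `im B`. -/
theorem infUnobservabilitySubspace_ne_top [FiniteDimensional ℝ U] [FiniteDimensional ℝ X]
    [FiniteDimensional ℝ Y] {C : X →ₗ[ℝ] Y} {A : X →ₗ[ℝ] X} {B : U →ₗ[ℝ] X}
    (h : IsWeaklyOutputRedundant C A B) : infUnobservabilitySubspace C A B ≠ ⊤ := by
  obtain ⟨W, hW⟩ := exists_eq_range_sup_map C A B
  have hA : W ⊓ LinearMap.ker C ≤ W.comap A := by
    rw [← Submodule.map_le_iff_le_comap]
    exact le_sup_right.trans hW.ge
  obtain ⟨L, hL⟩ := exists_isOutputFriend C A hA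
  have hlt : W.map C < ⊤ := by
    refine lt_top_iff_ne_top.2 fun htop => ?_
    have := finrank_map_le_of_eq_range_sup_map hW
    rw [htop, finrank_top] at this
    exact absurd h.1 this.not_gt
  obtain ⟨f, hf, hWf⟩ := Submodule.exists_le_ker_of_lt_top _ hlt
  obtain ⟨y, hy⟩ : ∃ y, f y ≠ 0 := by
    by_contra! h0
    exact hf (LinearMap.ext h0)
  have hC : LinearMap.range C = ⊤ := Submodule.eq_top_of_finrank_eq h.2
  obtain ⟨x, hx⟩ := LinearMap.range_eq_top.1 hC y
  have hy0 : y ≠ 0 := fun h0 => hy (by simp [h0])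
  let H : Y →ₗ[ℝ] Y := f.smulRight y
  have hWH : W ≤ LinearMap.ker (H ∘ₗ C) := fun w hw => by
    have : f (C w) = 0 := hWf ⟨w, hw, rfl⟩
    simp [H, this]
  intro htop
  have hle : infUnobservabilitySubspace C A B ≤ LinearMap.ker (H ∘ₗ C) :=
    (infUnobservabilitySubspace_le ⟨L, H, rfl⟩
      ((le_sup_left.trans hW.ge).trans (le_unobservableSubspace hL hWH))).trans
      (unobservableSubspace_le _ _)
  have hxk : x ∈ LinearMap.ker (H ∘ₗ C) := hle (htop ▸ Submodule.mem_top)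
  simp [H, hx, hy, hy0] at hxk

/-- For a friend `L` of `S*`, an `(A + L C)`-invariant subspace of `S* + ker C` lies in `S*`. -/
theorem le_infUnobservabilitySubspace {C : X →ₗ[ℝ] Y} {A : X →ₗ[ℝ] X} {B : U →ₗ[ℝ] X}
    {L : Y →ₗ[ℝ] X} (hL : IsOutputFriend C A (infUnobservabilitySubspace C A B) L)
    {N : Submodule ℝ X} (hN : IsInvariant (A + L ∘ₗ C) N)
    (hNS : N ≤ infUnobservabilitySubspace C A B ⊔ LinearMap.ker C) :
    N ≤ infUnobservabilitySubspace C A B := by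
  refine le_sInf ?_
  rintro S ⟨hS, hB⟩
  have hSS := infUnobservabilitySubspace_le hS hB
  obtain ⟨L', H, rfl⟩ := hS
  set S := unobservableSubspace (LinearMap.ker (H ∘ₗ C)) (A + L' ∘ₗ C) with hSdef
  have hinv : IsInvariant (A + L' ∘ₗ C) S := isInvariant_unobservableSubspace _ _
  have hSK : S ≤ LinearMap.ker (H ∘ₗ C) := unobservableSubspace_le _ _
  -- By maximality of `S`, it suffices that `N ⊔ S` is `(A + L' C)`-invariant and lies in `ker (H
  -- C)`. On `s + k` the two injections differ only through `C s`, and both closed-loop maps send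
  -- `s` into `S`.
  refine le_sup_left.trans (le_unobservableSubspace (W := N ⊔ S) (sup_le (fun n hn => ?_)
    (hinv.trans (Submodule.comap_mono le_sup_right))) (sup_le (hNS.trans
      (sup_le (hSS.trans hSK) (LinearMap.ker_le_ker_comp C H))) hSK))
  obtain ⟨s, hs, k, hk, rfl⟩ := Submodule.mem_sup.1 (hNS hn)
  have hk : C k = 0 := hk
  have h1 : (A + L ∘ₗ C) (s + k) ∈ N := hN hn
  have h2 : (A + L' ∘ₗ C) s ∈ S := hinv (hSS hs)
  have h3 : (A + L ∘ₗ C) s ∈ S := hSS (hL hs)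
  have h4 : (A + L' ∘ₗ C) (s + k) =
      (A + L ∘ₗ C) (s + k) + ((A + L' ∘ₗ C) s - (A + L ∘ₗ C) s) := by
    simp [hk]
  rw [Submodule.mem_comap, h4]
  exact Submodule.add_mem_sup h1 (S.sub_mem h2 h3)

theorem isObservable_quotient {C : X →ₗ[ℝ] Y} {A : X →ₗ[ℝ] X} {B : U →ₗ[ℝ] X}
    {L : Y →ₗ[ℝ] X} (hL : IsOutputFriend C A (infUnobservabilitySubspace C A B) L) :
    IsObservable (quotientOutput C (infUnobservabilitySubspace C A B)) (quotientState C A hL) := by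
  refine eq_bot_iff.2 (sSup_le ?_)
  rintro W ⟨hW, hK⟩
  have hle : W.comap (infUnobservabilitySubspace C A B).mkQ ≤
      infUnobservabilitySubspace C A B := by
    refine le_infUnobservabilitySubspace hL (fun x hx => hW hx) fun x hx => ?_
    have h0 : (Submodule.Quotient.mk (C x) :
        Y ⧸ (infUnobservabilitySubspace C A B).map C) = 0 := hK hx
    obtain ⟨s, hs, hsx⟩ := (Submodule.Quotient.mk_eq_zero _).1 h0
    exact Submodule.mem_sup.2 ⟨s, hs, x - s, by simp [hsx], by simp⟩
  intro w hw
  obtain ⟨x, rfl⟩ := Submodule.mkQ_surjective _ w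
  exact (Submodule.Quotient.mk_eq_zero _).2 (hle hw)

/-- Observability in terms of the maps `C Aʲ`. -/
theorem IsObservable.eq_zero {C : X →ₗ[ℝ] Y} {A : X →ₗ[ℝ] X} (h : IsObservable C A) {x : X}
    (hx : ∀ j : ℕ, C ((A ^ j) x) = 0) : x = 0 := by
  let W : Submodule ℝ X := ⨅ j : ℕ, LinearMap.ker (C ∘ₗ A ^ j)
  have hW : W ≤ unobservableSubspace (LinearMap.ker C) A := by
    refine le_unobservableSubspace (fun w hw => ?_) fun w hw => ?_
    · simp only [W, Submodule.mem_iInf, LinearMap.mem_ker, Submodule.mem_comap] at hw ⊢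
      intro j
      simpa [pow_succ] using hw (j + 1)
    · simpa using (Submodule.mem_iInf _).1 hw 0
  have hxW : x ∈ W := (Submodule.mem_iInf _).2 hx
  simpa [show unobservableSubspace (LinearMap.ker C) A = ⊥ from h] using hW hxW

end Geometric

/-! ### Left-invertibility from Markov parameters. -/

section LeftInvertible

variable {U X Y : Type*} [AddCommGroup U] [Module ℝ U] [AddCommGroup X] [Module ℝ X]
  [AddCommGroup Y] [Module ℝ Y]

/-- A linear differential equation with initial value zero has only the zero solution. -/
theorem eq_zero_of_hasDerivWithinAt [FiniteDimensional ℝ X] {T : ℝ} (M : X →ₗ[ℝ] X)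
    {z : ℝ → X} (h0 : z 0 = 0)
    (hz : ∀ t ∈ Set.Icc 0 T, ∀ φ : Module.Dual ℝ X,
      HasDerivWithinAt (fun s => φ (z s)) (φ (M (z t))) (Set.Icc 0 T) t) :
    ∀ t ∈ Set.Icc 0 T, z t = 0 := by
  let b := Module.finBasis ℝ X
  let e := b.equivFun
  let N := LinearMap.toContinuousLinearMap (e.toLinearMap ∘ₗ M ∘ₗ e.symm.toLinearMap)
  have hd : ∀ t ∈ Set.Icc 0 T, HasDerivWithinAt (fun s => e (z s)) (N (e (z t)))
      (Set.Icc 0 T) t := fun t ht => hasDerivWithinAt_pi.2 fun i => by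
    simpa [N, e] using hz t ht (b.coord i)
  have heq : Set.EqOn (fun s => e (z s)) (fun _ => 0) (Set.Icc 0 T) := by
    refine ODE_solution_unique (v := fun _ => N) (fun _ => N.lipschitz)
      (fun t ht => (hd t ht).continuousWithinAt)
      (fun t ht => (hd t (Set.Ico_subset_Icc_self ht)).mono_of_mem_nhdsWithin
        (Icc_mem_nhdsGE_of_mem ht)) continuousOn_const
      (fun t _ => by simpa using hasDerivWithinAt_const t (Set.Ici t) (0 : Fin _ → ℝ))
      (by simp [h0])
  exact fun t ht => by simpa using heq ht

/-- If the first nonzero Markov parameter `C Aᵏ B` is injective, then the system is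
left-invertible. -/
theorem isLeftInvertible_of_injective [FiniteDimensional ℝ X] {C : X →ₗ[ℝ] Y} {A : X →ₗ[ℝ] X}
    {B : U →ₗ[ℝ] X} {k : ℕ} (hlt : ∀ j < k, ∀ u, C ((A ^ j) (B u)) = 0)
    (hk : ∀ u, C ((A ^ k) (B u)) = 0 → u = 0) (𝕋 : TimeDomain) :
    IsLeftInvertible C A B 𝕋 := by
  -- `Ψ` expresses the input difference through the state difference, which therefore solves an
  -- autonomous linear equation with initial value zero.
  obtain ⟨Ψ, hΨ⟩ := (C ∘ₗ (A ^ k) ∘ₗ B).exists_leftInverse_of_injective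
    (LinearMap.ker_eq_bot'.2 hk)
  have hΨ : ∀ u, Ψ (C ((A ^ k) (B u))) = u := LinearMap.congr_fun hΨ
  have hinput : ∀ {x : X} {u : U}, C ((A ^ k) (A x + B u)) = 0 →
      u = -Ψ (C ((A ^ k) (A x))) := fun {x u} h => by
    rw [map_add, map_add] at h
    have h' := congrArg Ψ h
    rw [map_add, hΨ, map_zero] at h'
    exact eq_neg_of_add_eq_zero_right h'
  cases 𝕋 with
  | continuous T hT =>
    intro x₀ u₁ u₂ x₁ x₂ _ _ hx₁ hx₂ hC
    have hz : ∀ t ∈ Set.Icc 0 T, ∀ φ : Module.Dual ℝ X,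
        HasDerivWithinAt (fun s => φ (x₁ s - x₂ s))
          (φ (A (x₁ t - x₂ t) + B (u₁ t - u₂ t))) (Set.Icc 0 T) t := fun t ht φ => by
      have h := ((hx₁.2 t ht φ).sub (hx₂.2 t ht φ)).congr_deriv (g' := φ (A (x₁ t - x₂ t) +
        B (u₁ t - u₂ t))) (by simp only [map_sub, map_add]; ring)
      exact h.congr (fun s _ => map_sub φ _ _) (map_sub φ _ _)
    have hstep : ∀ j, (∀ t ∈ Set.Icc 0 T, C ((A ^ j) (x₁ t - x₂ t)) = 0) →
        ∀ t ∈ Set.Icc 0 T, C ((A ^ j) (A (x₁ t - x₂ t) + B (u₁ t - u₂ t))) = 0 := by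
      intro j hj t ht
      refine (Module.forall_dual_apply_eq_zero_iff ℝ _).1 fun φ => ?_
      have h1 := hz t ht (φ ∘ₗ C ∘ₗ A ^ j)
      have h2 : HasDerivWithinAt (fun s => (φ ∘ₗ C ∘ₗ A ^ j) (x₁ s - x₂ s)) 0
          (Set.Icc 0 T) t :=
        (hasDerivWithinAt_const t _ (0 : ℝ)).congr_of_mem (fun s hs => by
          simp only [LinearMap.comp_apply, hj s hs, map_zero]) ht
      -- Here `T > 0` matters: derivatives within `[0, T]` are unique, even at the end points.
      exact (uniqueDiffOn_Icc hT t ht).eq_deriv _ h1 h2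
    have hj : ∀ j ≤ k, ∀ t ∈ Set.Icc 0 T, C ((A ^ j) (x₁ t - x₂ t)) = 0 := by
      intro j
      induction j with
      | zero => intro _ t ht; simp [hC t ht]
      | succ j ih =>
        intro hjk t ht
        have := hstep j (ih (by omega)) t ht
        rw [map_add, map_add, hlt j (by omega), add_zero] at this
        simpa [pow_succ] using this
    have hu : ∀ t ∈ Set.Icc 0 T, u₁ t - u₂ t = -Ψ (C ((A ^ k) (A (x₁ t - x₂ t)))) :=
      fun t ht => hinput (hstep k (hj k le_rfl) t ht)
    have hzero := eq_zero_of_hasDerivWithinAt (T := T) (A - B ∘ₗ Ψ ∘ₗ C ∘ₗ (A ^ k) ∘ₗ A)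
      (z := fun t => x₁ t - x₂ t) (by simp [hx₁.1, hx₂.1]) fun t ht φ => by
        convert hz t ht φ using 2
        rw [hu t ht]
        simp [sub_eq_add_neg]
    intro t ht
    have h := hu t ht
    rw [hzero t ht] at h
    exact sub_eq_zero.1 (by simpa using h)
  | discrete =>
    intro x₀ u₁ u₂ x₁ x₂ hx₁ hx₂ hC
    have hz : ∀ t, x₁ (t + 1) - x₂ (t + 1) = A (x₁ t - x₂ t) + B (u₁ t - u₂ t) := fun t => by
      rw [hx₁.2, hx₂.2, map_sub, map_sub]; abel
    have hj : ∀ j ≤ k, ∀ t, C ((A ^ j) (x₁ t - x₂ t)) = 0 := by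
      intro j
      induction j with
      | zero => intro _ t; simp [hC t]
      | succ j ih =>
        intro hjk t
        have := ih (by omega) (t + 1)
        rw [hz, map_add, map_add, hlt j (by omega), add_zero] at this
        simpa [pow_succ] using this
    have hu : ∀ t, u₁ t - u₂ t = -Ψ (C ((A ^ k) (A (x₁ t - x₂ t)))) := fun t =>
      hinput (hz t ▸ hj k le_rfl (t + 1))
    have hzero : ∀ t, x₁ t - x₂ t = 0 := by
      intro t
      induction t with
      | zero => rw [hx₁.1, hx₂.1, sub_self]
      | succ t ih => rw [hz, hu, ih]; simp
    intro t
    have h := hu t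
    rw [hzero t] at h
    exact sub_eq_zero.1 (by simpa using h)

/-- An observable system with a scalar input that enters effectively is left-invertible. -/
theorem IsObservable.isLeftInvertible_span [FiniteDimensional ℝ X] {C : X →ₗ[ℝ] Y}
    {A : X →ₗ[ℝ] X} (h : IsObservable C A) {d : U} (B : Submodule.span ℝ {d} →ₗ[ℝ] X)
    (hB : B ⟨d, Submodule.mem_span_singleton_self d⟩ ≠ 0) (𝕋 : TimeDomain) :
    IsLeftInvertible C A B 𝕋 := by
  classical
  set d' : Submodule.span ℝ {d} := ⟨d, Submodule.mem_span_singleton_self d⟩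
  have hspan : ∀ u : Submodule.span ℝ {d}, ∃ a : ℝ, u = a • d' := fun u => by
    obtain ⟨a, ha⟩ := Submodule.mem_span_singleton.1 u.2
    exact ⟨a, Subtype.ext ha.symm⟩
  have hex : ∃ k : ℕ, C ((A ^ k) (B d')) ≠ 0 := by
    by_contra! h0
    exact hB (h.eq_zero h0)
  refine isLeftInvertible_of_injective (k := Nat.find hex) (fun j hj u => ?_) (fun u hu => ?_) 𝕋
  · obtain ⟨a, rfl⟩ := hspan u
    simp [not_not.1 (Nat.find_min hex hj)]
  · obtain ⟨a, rfl⟩ := hspan u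
    have ha : a = 0 := by simpa [Nat.find_spec hex] using hu
    simp [ha]

end LeftInvertible

end LTI

theorem mainTheorem2 {U X Y : Type*}
    [AddCommGroup U] [Module ℝ U] [FiniteDimensional ℝ U]
    [AddCommGroup X] [Module ℝ X] [FiniteDimensional ℝ X]
    [AddCommGroup Y] [Module ℝ Y] [FiniteDimensional ℝ Y]
    (𝕋 : LTI.TimeDomain)
    (A : X →ₗ[ℝ] X) (B : U →ₗ[ℝ] X) (C : X →ₗ[ℝ] Y)
    (hctrl : LTI.IsControllable A B) (hobs : LTI.IsObservable C A)
    (hinv : LTI.IsLeftInvertible C A B 𝕋)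
    (hWOR : LTI.IsWeaklyOutputRedundant C A B)
    (L : Y →ₗ[ℝ] X)
    (hL : LTI.IsOutputFriend C A (LTI.infUnobservabilitySubspace C A B) L) :
    ∃ D : Submodule ℝ Y, D ≠ ⊥ ∧ D ≤ (LTI.infUnobservabilitySubspace C A B).map C ∧
      LTI.IsLeftInvertible
        (LTI.quotientOutput C (LTI.infUnobservabilitySubspace C A B))
        (LTI.quotientState C A hL)
        (LTI.quotientDisturbance (LTI.infUnobservabilitySubspace C A B) L D) 𝕋 := by
  obtain ⟨d, hd, hLd⟩ : ∃ d ∈ (LTI.infUnobservabilitySubspace C A B).map C,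
      L d ∉ LTI.infUnobservabilitySubspace C A B := by
    by_contra! h
    refine LTI.infUnobservabilitySubspace_ne_top hWOR (hctrl.eq_top (fun x hx => ?_)
      (LTI.range_le_infUnobservabilitySubspace C A B))
    have h1 : A x + L (C x) ∈ LTI.infUnobservabilitySubspace C A B := hL hx
    exact (Submodule.add_mem_iff_left _ (h _ ⟨x, hx, rfl⟩)).1 h1
  refine ⟨Submodule.span ℝ {d}, ?_, by simpa using hd,
    (LTI.isObservable_quotient hL).isLeftInvertible_span _ ?_ 𝕋⟩
  · rw [Ne, Submodule.span_singleton_eq_bot]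
    rintro rfl
    exact hLd (by simp)
  · exact fun h0 => hLd ((Submodule.Quotient.mk_eq_zero _).1 h0)
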